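/- A \emph{compact ordered space} is a compact topological space $X$ equipped with a partial order $\leq$ that is a closed subset of $X\times X$. Let $\mathsf{CompOrd}$ be the category of compact ordered spaces and order-preserving continuous maps. Let $\Sigma$ be a (possibly large) signature all of whose operation symbols have finite arity, and let $\mathcal{K}$ be a class of $\Sigma$-algebras closed under products and subalgebras, that is: every $\Sigma$-algebra isomorphic to the direct product (with coordinatewise operations) of a set-indexed, possibly empty, family of members of $\mathcal{K}$ belongs to $\mathcal{K}$, and every subalgebra of a member of $\mathcal{K}$ (including the empty one, when $\Sigma$ has no constant symbols) belongs to $\mathcal{K}$. Regard $\mathcal{K}$ as a category whose morphisms are all $\Sigma$-homomorphisms. Then $\mathsf{CompOrd}^{\mathrm{op}}$ is not equivalent to $\mathcal{K}$. -/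

import Mathlib

open CategoryTheory FirstOrder

universe u v w

/-- A compact ordered space: a compact topological space with a partial order that is closed as a
subset of the square of the space (`OrderClosedTopology`). -/
structure CompOrd : Type (u + 1) where
  of ::
  carrier : Type u
  [topology : TopologicalSpace carrier]
  [order : PartialOrder carrier]
  [compact : CompactSpace carrier]
  [closed : OrderClosedTopology carrier]

namespace CompOrd

instance : CoeSort CompOrd.{u} (Type u) := ⟨CompOrd.carrier⟩

attribute [instance] topology order compact closed

/-- Morphisms of compact ordered spaces are the order-preserving continuous maps. -/
@[ext]
structure Hom (X Y : CompOrd.{u}) : Type u where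
  hom : X →Co Y

instance : Category.{u} CompOrd.{u} where
  Hom X Y := Hom X Y
  id X := ⟨ContinuousOrderHom.id X⟩
  comp f g := ⟨g.hom.comp f.hom⟩

end CompOrd

/-- Structures for a first-order language, on types of universe `u`. If the language has no relation
symbols, it is a signature of operation symbols of finite arity, and these structures are exactly
the (finitary) algebras of that signature. The signature may be large compared to `u`, and the
empty algebra is allowed if there are no constant symbols. -/
structure FinitaryAlg (L : FirstOrder.Language.{v, w}) : Type (max (u + 1) v w) where
  of ::
  carrier : Type u
  [str : L.Structure carrier]

namespace FinitaryAlg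

variable {L : FirstOrder.Language.{v, w}}

instance : CoeSort (FinitaryAlg.{u} L) (Type u) := ⟨FinitaryAlg.carrier⟩

attribute [instance] str

/-- Morphisms of algebras are the homomorphisms. -/
@[ext]
structure Hom (A B : FinitaryAlg.{u} L) : Type u where
  hom : A →[L] B

instance : Category.{u} (FinitaryAlg.{u} L) where
  Hom A B := Hom A B
  id A := ⟨FirstOrder.Language.Hom.id L A⟩
  comp f g := ⟨g.hom.comp f.hom⟩

/-- The set-theoretic direct product of a family of algebras, with coordinatewise operations. -/
def prod {I : Type u} (A : I → FinitaryAlg.{u} L) : FinitaryAlg.{u} L where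
  carrier := ∀ i, A i
  str :=
    { funMap := fun f x i => FirstOrder.Language.Structure.funMap f fun k => x k i
      RelMap := fun r x => ∀ i, FirstOrder.Language.Structure.RelMap r fun k => x k i }

/-- A class of algebras is closed under products if it contains every algebra isomorphic to the
set-theoretic direct product of a (possibly empty) small family of its members. -/
def ClosedUnderProducts (K : ObjectProperty (FinitaryAlg.{u} L)) : Prop :=
  ∀ (I : Type u) (A : I → FinitaryAlg.{u} L), (∀ i, K (A i)) →
    ∀ B : FinitaryAlg.{u} L, Nonempty (B ≃[L] prod A) → K B

/-- A class of algebras is closed under subalgebras. -/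
def ClosedUnderSubalgebras (K : ObjectProperty (FinitaryAlg.{u} L)) : Prop :=
  ∀ A : FinitaryAlg.{u} L, K A → ∀ S : L.Substructure A, K (FinitaryAlg.of S)

end FinitaryAlg

namespace CompOrd

/-! Finitary operations clash with connectedness. In the algebra dual to the Cantor space, the
elements fixed by some truncation form a subalgebra, because arities are finite. This subalgebra is
dual to a quotient-like map `r` out of the Cantor space through which every truncation factors. The
digits then glue to a retraction of `r`, so the subalgebra is everything
(`exists_dualMap_truncate_eq`).

Now map the Cantor space onto the unit interval. An element `a` of the interval's dual generates a
subalgebra, dual to some map `g` out of the interval. Since the image of `a` is fixed by a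
truncation, `g` has finite range, hence is constant by connectedness (`constant_of_truncate`). So no
`a` separates two points of the interval, against faithfulness of the duality. -/

theorem hom_ext_apply {X Y : CompOrd.{u}} {f g : X ⟶ Y}
    (h : ∀ x, Hom.hom f x = Hom.hom g x) : f = g :=
  Hom.ext (DFunLike.ext _ _ h)

/-- A compact Hausdorff space, with the equality relation as its order. -/
def discrete (X : Type u) [TopologicalSpace X] [CompactSpace X] [T2Space X] : CompOrd.{u} :=
  letI : PartialOrder X :=
    { le := Eq
      le_refl := Eq.refl
      le_trans := fun _ _ _ => Eq.trans
      le_antisymm := fun _ _ h _ => h }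
  haveI : OrderClosedTopology X := ⟨isClosed_diagonal⟩
  CompOrd.of X

section

variable {X : Type u} [TopologicalSpace X] [CompactSpace X] [T2Space X]

/-- A continuous map, as a morphism out of a discretely ordered space. -/
def ofContinuous {Y : CompOrd.{u}} (f : X → Y) (hf : Continuous f) : discrete X ⟶ Y :=
  ⟨{ toFun := f
     monotone' := fun _ _ h => (congrArg f h).le
     continuous_toFun := hf }⟩

/-- A continuous map identifying comparable points, as a morphism to a discretely ordered space. -/
def toDiscrete {Y : CompOrd.{u}} (f : Y → X) (hf : Continuous f)
    (h : ∀ x y, x ≤ y → f x = f y) : Y ⟶ discrete X :=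
  ⟨{ toFun := f
     monotone' := h
     continuous_toFun := hf }⟩

theorem hom_apply_eq_of_le {Y : CompOrd.{u}} (f : Y ⟶ discrete X) {x y : Y} (h : x ≤ y) :
    (Hom.hom f x : X) = Hom.hom f y :=
  (Hom.hom f).monotone' h

end

/-- The Cantor space, discretely ordered. -/
def cantor : CompOrd.{u} :=
  discrete (ULift.{u} (ℕ → Bool))

/-- The digits of a point of the Cantor space. -/
def digit (x : cantor.{u}) : ℕ → Bool :=
  ULift.down (α := ℕ → Bool) x

theorem continuous_digit : Continuous digit.{u} :=
  continuous_uliftDown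

theorem digit_injective : Function.Injective digit.{u} :=
  ULift.down_injective

/-- The endomorphism of the Cantor space that resets all digits from position `n` on. -/
def truncate (n : ℕ) : cantor.{u} ⟶ cantor.{u} :=
  ofContinuous (Y := cantor.{u})
    (fun x => ULift.up fun k => if k < n then x.down k else false) <| by
    refine continuous_uliftUp.comp (continuous_pi fun k => ?_)
    split_ifs
    · exact (continuous_apply k).comp continuous_uliftDown
    · exact continuous_const

theorem digit_truncate (n : ℕ) (x : cantor.{u}) (k : ℕ) :
    digit (Hom.hom (truncate n) x) k = if k < n then digit x k else false :=
  rfl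

theorem truncate_comp_truncate {m n : ℕ} (h : m ≤ n) :
    truncate.{u} n ≫ truncate m = truncate m :=
  hom_ext_apply fun x => digit_injective <| funext fun k => by
    change digit (Hom.hom (truncate m) (Hom.hom (truncate n) x)) k = _
    simp only [digit_truncate]
    grind

theorem finite_range_truncate (n : ℕ) : (Set.range (Hom.hom (truncate.{u} n))).Finite := by
  let r : (Fin n → Bool) → cantor.{u} :=
    fun v => ULift.up fun k => if h : k < n then v ⟨k, h⟩ else false
  refine (Set.finite_range r).subset ?_
  rintro _ ⟨x, rfl⟩
  refine ⟨fun i => digit x i, digit_injective <| funext fun k => ?_⟩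
  rw [digit_truncate]
  change (if h : k < n then digit x k else false) = _
  split_ifs <;> rfl

/-- A morphism out of the Cantor space that becomes the truncations after composition with suitable
morphisms is a split monomorphism. -/
theorem exists_retraction_of_truncate {Y : CompOrd.{u}} (r : cantor ⟶ Y)
    (h : ∀ n, ∃ s : Y ⟶ cantor, r ≫ s = truncate n) : ∃ s : Y ⟶ cantor, r ≫ s = 𝟙 cantor := by
  choose s hs using h
  -- Digit `k` is read off `s (k + 1)`, since truncation at `k + 1` keeps it. The `s n` need not be
  -- compatible: continuity and monotonicity are checked digit by digit.
  refine ⟨toDiscrete (X := ULift.{u} (ℕ → Bool))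
    (fun y => ULift.up fun k => digit (Hom.hom (s (k + 1)) y) k) ?_ ?_, ?_⟩
  · exact continuous_uliftUp.comp <| continuous_pi fun k =>
      (continuous_apply k).comp (continuous_digit.comp (Hom.hom (s (k + 1))).continuous_toFun)
  · intro x y hxy
    refine congrArg ULift.up (funext fun k => ?_)
    exact congrFun (congrArg digit (hom_apply_eq_of_le (s (k + 1)) hxy)) k
  · refine hom_ext_apply fun x => digit_injective <| funext fun k => ?_
    change digit (Hom.hom (r ≫ s (k + 1)) x) k = digit x k
    rw [hs, digit_truncate, if_pos k.lt_succ_self]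

/-- A morphism on the discretely ordered unit interval is constant if its composite with some
surjection from the Cantor space factors through a truncation. -/
theorem constant_of_truncate {P : CompOrd.{u}} (f : cantor ⟶ discrete (ULift.{u} unitInterval))
    (hf : Function.Surjective (Hom.hom f)) (g : discrete (ULift.{u} unitInterval) ⟶ P) (n : ℕ)
    (h : truncate n ≫ f ≫ g = f ≫ g) (x y : discrete (ULift.{u} unitInterval)) :
    Hom.hom g x = Hom.hom g y := by
  have hfin : (Set.range (Hom.hom g)).Finite := by
    refine ((finite_range_truncate n).image (Hom.hom (f ≫ g))).subset ?_
    rintro _ ⟨z, rfl⟩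
    obtain ⟨c, rfl⟩ := hf z
    refine ⟨_, ⟨c, rfl⟩, ?_⟩
    exact congrArg (fun k => Hom.hom k c) h
  have hconn : _root_.IsPreconnected (Set.range (Hom.hom g)) := by
    have : PreconnectedSpace (discrete (ULift.{u} unitInterval)) :=
      Homeomorph.ulift.symm.surjective.denseRange.preconnectedSpace
        (Homeomorph.ulift.{u} (X := unitInterval)).symm.continuous
    exact isPreconnected_range (Hom.hom g).continuous_toFun
  have := mt hconn.infinite_of_nontrivial (Set.not_infinite.2 hfin)
  exact Set.not_nontrivial_iff.1 this ⟨x, rfl⟩ ⟨y, rfl⟩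

theorem exists_surjective_cantor_unitInterval :
    ∃ f : cantor ⟶ discrete (ULift.{u} unitInterval), Function.Surjective (Hom.hom f) := by
  obtain ⟨f, hf, hs⟩ := exists_nat_bool_continuous_surjective_of_compact unitInterval
  refine ⟨ofContinuous (Y := discrete (ULift.{u} unitInterval)) (fun x => ULift.up (f x.down))
    (continuous_uliftUp.comp (hf.comp continuous_uliftDown)), ?_⟩
  rintro ⟨z⟩
  obtain ⟨c, rfl⟩ := hs z
  exact ⟨ULift.up c, rfl⟩

end CompOrd

namespace FinitaryAlg

variable {L : FirstOrder.Language.{v, w}} {K : ObjectProperty (FinitaryAlg.{u} L)}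
  (E : CompOrd.{u}ᵒᵖ ≌ K.FullSubcategory)

/-- The algebra corresponding to a compact ordered space under a dual equivalence. -/
abbrev dual (X : CompOrd.{u}) : FinitaryAlg.{u} L :=
  (E.functor.obj (Opposite.op X)).obj

/-- The homomorphism corresponding to a morphism under a dual equivalence. -/
def dualMap {X Y : CompOrd.{u}} (f : X ⟶ Y) : dual E Y →[L] dual E X :=
  Hom.hom (E.functor.map f.op).hom

theorem dualMap_id (X : CompOrd.{u}) (a : dual E X) : dualMap E (𝟙 X) a = a := by
  have := E.functor.map_id (Opposite.op X)
  exact congrArg (fun k => Hom.hom k.hom a) this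

theorem dualMap_comp {X Y Z : CompOrd.{u}} (f : X ⟶ Y) (g : Y ⟶ Z) (a : dual E Z) :
    dualMap E (f ≫ g) a = dualMap E f (dualMap E g a) := by
  have := E.functor.map_comp g.op f.op
  exact congrArg (fun k => Hom.hom k.hom a) this

theorem dualMap_injective {X Y : CompOrd.{u}} {f g : X ⟶ Y}
    (h : ∀ a, dualMap E f a = dualMap E g a) : f = g := by
  refine Quiver.Hom.op_inj (E.functor.map_injective (InducedCategory.hom_ext (Hom.ext ?_)))
  exact DFunLike.ext _ _ h

theorem exists_dualMap_eq {X Y : CompOrd.{u}} (φ : dual E Y →[L] dual E X) :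
    ∃ f : X ⟶ Y, dualMap E f = φ := by
  let φ' : E.functor.obj (Opposite.op Y) ⟶ E.functor.obj (Opposite.op X) :=
    ObjectProperty.homMk (Hom.mk φ)
  refine ⟨(E.functor.preimage φ').unop, ?_⟩
  have := E.functor.map_preimage φ'
  exact congrArg (fun k => Hom.hom k.hom) this

/-- A subalgebra of the dual of `X` is the dual of some space under `X`. -/
theorem exists_dual_subalgebra (hS : ClosedUnderSubalgebras K) {X : CompOrd.{u}}
    (S : L.Substructure (dual E X)) :
    ∃ (Y : CompOrd.{u}) (r : X ⟶ Y) (e : S →[L] dual E Y),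
      (∀ b, dualMap E r b ∈ S) ∧ ∀ a : S, dualMap E r (e a) = a := by
  let A : K.FullSubcategory := ⟨FinitaryAlg.of S, hS _ (E.functor.obj (Opposite.op X)).2 S⟩
  let i : E.functor.obj (E.inverse.obj A) ≅ A := E.counitIso.app A
  obtain ⟨r, hr⟩ := exists_dualMap_eq E (Y := (E.inverse.obj A).unop)
    (S.subtype.toHom.comp (Hom.hom i.hom.hom))
  refine ⟨(E.inverse.obj A).unop, r, Hom.hom i.inv.hom, fun b => ?_, fun a => ?_⟩
  · rw [hr]
    exact (Hom.hom i.hom.hom b : S).2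
  · rw [hr]
    have := i.inv_hom_id
    exact congrArg (fun k => ((Hom.hom (InducedCategory.Hom.hom k) a : S) : dual E X)) this

open CompOrd in
/-- The elements of the dual of the Cantor space that depend on finitely many digits only. -/
def finiteSupport : L.Substructure (dual E cantor) where
  carrier := {a | ∃ n, dualMap E (truncate n) a = a}
  fun_mem {k} f x hx := by
    choose n hn using hx
    -- Finite arity is essential here: finitely many truncation levels have a common bound.
    refine ⟨Finset.univ.sup n, ?_⟩
    rw [FirstOrder.Language.Hom.map_fun]
    congr 1
    funext i
    change dualMap E (truncate _) (x i) = x i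
    rw [← hn i, ← dualMap_comp, truncate_comp_truncate (Finset.le_sup (Finset.mem_univ i))]

open CompOrd in
theorem exists_dualMap_truncate_eq (hS : ClosedUnderSubalgebras K) (a : dual E cantor) :
    ∃ n, dualMap E (truncate n) a = a := by
  obtain ⟨Y, r, e, hr, he⟩ := exists_dual_subalgebra E hS (finiteSupport E)
  obtain ⟨s, hs⟩ := exists_retraction_of_truncate r fun n => by
    have hn : ∀ b, dualMap E (truncate n) b ∈ finiteSupport E := fun b =>
      ⟨n, by rw [← dualMap_comp, truncate_comp_truncate le_rfl]⟩
    -- The dual of a truncation lands in `finiteSupport`, so it factors through the dual of `r`.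
    obtain ⟨s, hs⟩ := exists_dualMap_eq E (e.comp ((dualMap E (truncate n)).codRestrict _ hn))
    refine ⟨s, dualMap_injective E fun b => ?_⟩
    rw [dualMap_comp, hs]
    exact he _
  -- The retraction puts every `a` in the image of the dual of `r`, which lies in `finiteSupport`.
  rw [← dualMap_id E _ a, ← hs, dualMap_comp]
  exact hr _

end FinitaryAlg

open CompOrd FinitaryAlg in
/-- The category of compact ordered spaces is not dually equivalent to any class of finitary
algebras (with homomorphisms) closed under products and subalgebras. -/
theorem mainTheorem5 (L : FirstOrder.Language.{v, w}) [L.IsAlgebraic]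
    (K : CategoryTheory.ObjectProperty (FinitaryAlg.{u} L))
    (hP : FinitaryAlg.ClosedUnderProducts K)
    (hS : FinitaryAlg.ClosedUnderSubalgebras K) :
    IsEmpty (CompOrd.{u}ᵒᵖ ≌ K.FullSubcategory) := by
  refine ⟨fun E => ?_⟩
  let I : CompOrd.{u} := discrete (ULift.{u} unitInterval)
  let point (t : I) : discrete PUnit.{u + 1} ⟶ I := ofContinuous (fun _ => t) continuous_const
  obtain ⟨f, hf⟩ := exists_surjective_cantor_unitInterval.{u}
  have key (x y : I) (a : dual E I) :
      dualMap E (point x) a = dualMap E (point y) a := by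
    -- With a single generator, one truncation level `n` serves for all of `S`.
    let S : L.Substructure (dual E I) := FirstOrder.Language.Substructure.closure L {a}
    have ha : a ∈ S := FirstOrder.Language.Substructure.subset_closure rfl
    obtain ⟨P, g, e, hg, he⟩ := exists_dual_subalgebra E hS S
    obtain ⟨n, hn⟩ := exists_dualMap_truncate_eq E hS (dualMap E f a)
    have hS' : Set.EqOn ((dualMap E (truncate n)).comp (dualMap E f)) (dualMap E f) S :=
      FirstOrder.Language.Hom.eqOn_closure fun b hb => by
        rw [Set.mem_singleton_iff.1 hb]
        exact hn
    have hconst := constant_of_truncate f hf g n (dualMap_injective E fun b => by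
      simp only [dualMap_comp]
      exact hS' (hg b)) x y
    have hpt : point x ≫ g = point y ≫ g := hom_ext_apply fun _ => hconst
    -- As `a` comes from the dual of `P`, evaluating it at a point depends only on the image of that
    -- point under `g`.
    have hga : dualMap E g (e ⟨a, ha⟩) = a := he ⟨a, ha⟩
    rw [← hga, ← dualMap_comp, ← dualMap_comp, hpt]
  have h01 : point (ULift.up 0) = point (ULift.up 1) := dualMap_injective E (key _ _)
  have : (ULift.up 0 : ULift.{u} unitInterval) = ULift.up 1 :=
    congrArg (fun k => CompOrd.Hom.hom k PUnit.unit) h01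
  exact zero_ne_one (ULift.up_injective this)
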